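/- Let $s\ge 1$ be an integer and let $\Omega,\Lambda>0$ be real numbers with $\Omega\Lambda<1/2$. Let $S_{[0,\Lambda],s}$ be the set of complex measures $\mu=\sum_{j=1}^{s}c_j\delta_{t_j}$ with $c\in\mathbb{C}^s$ and $0\le t_1<t_2<\dots<t_s\le\Lambda$ (coefficients may vanish), and let $\hat\mu(\omega)=\sum_{j=1}^{s}c_je^{-2\pi i\omega t_j}$ for $\omega\in\mathbb{R}$. Write $[\mu]=\{u\mu: u\in\mathbb{C},\ |u|=1\}$. Let $V=\{v_1,\dots,v_n\}$ be a set of $n$ distinct points of $[-\Omega,\Omega]$ and let $\Gamma=(V,E)$ be a simple graph with vertex set $V$. Define $$\mathcal{M}_{0,\Gamma}(\hat\mu)=\bigl(|\hat\mu(v_j)|^2\bigr)_{j=1}^{n},\qquad \mathcal{M}_{1,\Gamma}(\hat\mu)=\bigl(|\hat\mu(v_j)-\hat\mu(v_k)|^2\bigr)_{\{v_j,v_k\}\in E,\ j<k},\qquad \mathcal{M}_{2,\Gamma}(\hat\mu)=\bigl(|\hat\mu(v_j)-i\hat\mu(v_k)|^2\bigr)_{\{v_j,v_k\}\in E,\ j<k}.$$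 Let $\mu\in S_{[0,\Lambda],s}$, and let $\Gamma_\mu$ be the subgraph of $\Gamma$ induced by $\{v\in V:\hat\mu(v)\neq 0\}$. Suppose that $\Gamma_\mu$ has a connected component with at least $$\Bigl(2+\frac{12}{\ln\bigl(2s/(\Lambda\Omega)\bigr)}\Bigr)s$$ vertices. Then $\mathcal{M}_{0,\Gamma}(\hat\mu)$, $\mathcal{M}_{1,\Gamma}(\hat\mu)$ and $\mathcal{M}_{2,\Gamma}(\hat\mu)$ determine $[\mu]$ within $S_{[0,\Lambda],s}$: if $\nu\in S_{[0,\Lambda],s}$ satisfies $\mathcal{M}_{i,\Gamma}(\hat\nu)=\mathcal{M}_{i,\Gamma}(\hat\mu)$ for $i=0,1,2$, then $[\nu]=[\mu]$. -/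

import Mathlib

open MeasureTheory

namespace SpikePhase

noncomputable section

/-- The complex Dirac measure of mass one at `t`. -/
def diracC (t : ℝ) : ComplexMeasure ℝ := VectorMeasure.dirac t (1 : ℂ)

/-- The set of complex measures `∑ j, c j • δ_{t j}` with `s` terms and nodes
`0 ≤ t 0 < t 1 < ⋯ ≤ Λ`; coefficients may vanish. -/
def sparseMeasures (Λ : ℝ) (s : ℕ) : Set (ComplexMeasure ℝ) :=
  {μ | ∃ (c : Fin s → ℂ) (t : Fin s → ℝ), StrictMono t ∧ (∀ j, t j ∈ Set.Icc 0 Λ) ∧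
    μ = ∑ j, c j • diracC (t j)}

/-- The Fourier transform `ω ↦ ∫ exp (-2πiωt) dμ(t)` of a complex measure on the line. -/
def fourierC (μ : ComplexMeasure ℝ) (ω : ℝ) : ℂ :=
  μ.integral (fun t : ℝ => Complex.exp (-(2 * Real.pi * Complex.I * ω * t)))
    (ContinuousLinearMap.mul ℝ ℂ)

/-- On a linear combination of Dirac measures the Fourier transform is the exponential sum. -/
theorem fourierC_sum_dirac {s : ℕ} (c : Fin s → ℂ) (t : Fin s → ℝ) (ω : ℝ) :
    fourierC (∑ j, c j • diracC (t j)) ω =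
      ∑ j, c j * Complex.exp (-(2 * Real.pi * Complex.I * ω * t j)) := by
  have key : ∀ j, c j • diracC (t j) = VectorMeasure.dirac (t j) (c j) := by
    intro j
    ext i hi
    by_cases h : t j ∈ i
    · simp [diracC, VectorMeasure.dirac_apply_of_mem hi h]
    · simp [diracC, VectorMeasure.dirac_apply_of_notMem h]
  simp only [key, fourierC]
  rw [VectorMeasure.integral_finsetSum_vectorMeasure]
  · refine Finset.sum_congr rfl fun j _ => ?_
    rw [VectorMeasure.integral_dirac]
    simp [mul_comm]
  · intro j _
    rw [VectorMeasure.Integrable, VectorMeasure.variation_dirac]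
    refine Integrable.smul_measure ?_ (by simp)
    exact integrable_dirac (by simp)

/-- `μ ∼ ν`: equality of the classes `[μ] = [ν]` modulo unimodular factors. -/
def PhaseEquiv (μ ν : ComplexMeasure ℝ) : Prop :=
  ∃ u : ℂ, ‖u‖ = 1 ∧ μ = u • ν

/-- The index set of the edges `{v j, v k}`, each listed once, as the pair with `j < k`. -/
abbrev EdgeIndex {n : ℕ} (Γ : SimpleGraph (Fin n)) : Type :=
  {p : Fin n × Fin n // Γ.Adj p.1 p.2 ∧ p.1 < p.2}

/-- `(|f (v j)|²)_j`. -/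
def M₀ {n : ℕ} (v : Fin n → ℝ) (f : ℝ → ℂ) : Fin n → ℝ :=
  fun j => ‖f (v j)‖ ^ 2

/-- `(|f (v j) - f (v k)|²)` over the edges, `j < k`. -/
def M₁ {n : ℕ} (v : Fin n → ℝ) (Γ : SimpleGraph (Fin n)) (f : ℝ → ℂ) : EdgeIndex Γ → ℝ :=
  fun e => ‖f (v e.1.1) - f (v e.1.2)‖ ^ 2

/-- `(|f (v j) - i f (v k)|²)` over the edges, `j < k`. -/
def M₂ {n : ℕ} (v : Fin n → ℝ) (Γ : SimpleGraph (Fin n)) (f : ℝ → ℂ) : EdgeIndex Γ → ℝ :=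
  fun e => ‖f (v e.1.1) - Complex.I * f (v e.1.2)‖ ^ 2

/-- The subgraph of `Γ` induced by the vertices at which `f` does not vanish. -/
abbrev nonvanishingSubgraph {n : ℕ} (v : Fin n → ℝ) (Γ : SimpleGraph (Fin n)) (f : ℝ → ℂ) :
    SimpleGraph {j : Fin n | f (v j) ≠ 0} :=
  Γ.induce {j : Fin n | f (v j) ≠ 0}

end

end SpikePhase

open SpikePhase

/-! Across an edge of the nonvanishing subgraph the measurements determine the ratio of the two
values, so the quotient of the transforms of `ν` and `μ` is a constant `u` on a connected component,
and `|u| = 1`. The threshold exceeds `2 s`, so the transform of `ν - u μ`, an exponential sum with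
at most `2 s` frequencies, has more than `2 s` zeros in `[-Ω, Ω]`. Such a sum has only zero
coefficients (`expSum_coeff_eq_zero`).

Zeros of this complex-valued function are counted by turning, the total angle swept around the
origin. Since the angle with the zero vector is `π / 2`, every interior zero costs `π`
(`TurningLE.card_zeros_le`). A curve turns at most `π` more than its velocity
(`TurningLE.of_hasDerivAt`), and modulation by `exp (iβx)` adds at most `β (b - a)`
(`TurningLE.exp_mul`). Dividing out the lowest frequency and differentiating kills one term, so by
induction `k + 1` distinct frequencies in `[0, β]` with nonzero coefficients turn by at most `kπ + β
(b - a)` (`turningLE_expSum`). For `β = 2πΛ` and an interval slightly longer than `[-Ω, Ω]`, the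
condition `ΩΛ < 1/2` keeps this below `(k + 2)π`, which leaves at most `k + 1` zeros.

The Rolle-type step is first proved for polygons. It passes to curves because a chord of `f` is a
limit of Riemann sums of its derivative, and merging consecutive vectors into their sum never
increases turning. -/

namespace SpikePhase

open InnerProductGeometry Filter Topology

/-! ### Turning of finite sequences of vectors -/

section Turning

variable {V : Type*} [NormedAddCommGroup V] [InnerProductSpace ℝ V]

/-- The total turning of a finite sequence of vectors: the sum of the angles between consecutive
vectors. Passing through the zero vector costs `π / 2 + π / 2`. -/
noncomputable def turning : List V → ℝ
  | [] => 0
  | [_] => 0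
  | x :: y :: l => angle x y + turning (y :: l)

@[simp] theorem turning_nil : turning ([] : List V) = 0 := by simp [turning]

@[simp] theorem turning_singleton (x : V) : turning [x] = 0 := by simp [turning]

@[simp] theorem turning_cons_cons (x y : V) (l : List V) :
    turning (x :: y :: l) = angle x y + turning (y :: l) := by simp [turning]

theorem turning_cons_le (x y : V) (l : List V) :
    turning (x :: l) ≤ angle x y + turning (y :: l) := by
  cases l with
  | nil => simpa using angle_nonneg x y
  | cons z l =>
    simp only [turning_cons_cons]
    linarith [angle_le_angle_add_angle x y z]

/-- A prefix interacts with the tail only through its last vector, so one preceding vector `a` is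
the only case to compare. -/
theorem turning_append_mono (A : List V) {l l' : List V}
    (h₀ : turning l ≤ turning l') (h : ∀ a, turning (a :: l) ≤ turning (a :: l')) :
    turning (A ++ l) ≤ turning (A ++ l') := by
  induction A with
  | nil => simpa using h₀
  | cons a A ih =>
    cases A with
    | nil => simpa using h a
    | cons b A => simpa using ih

/-- Replacing two consecutive vectors by their sum does not increase the turning. -/
theorem turning_append_add_le (A : List V) (u v : V) (l : List V) :
    turning (A ++ (u + v) :: l) ≤ turning (A ++ u :: v :: l) := by
  rcases eq_or_ne v 0 with rfl | hv
  · rw [add_zero]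
    refine turning_append_mono A ?_ fun a => ?_
    · rw [turning_cons_cons]
      exact turning_cons_le _ _ _
    · simp only [turning_cons_cons]
      gcongr
      exact turning_cons_le _ _ _
  -- The sum `u + v` lies in the sector between `u` and `v`, so it splits their angle additively.
  · have h := angle_eq_angle_add_add_angle_add u hv
    have h₁ := turning_cons_le (u + v) v l
    rw [angle_comm (u + v) v] at h₁
    refine turning_append_mono A ?_ fun a => ?_
    · rw [turning_cons_cons]
      linarith [angle_nonneg u (u + v)]
    · simp only [turning_cons_cons]
      linarith [angle_le_angle_add_angle a u (u + v)]

/-- Replacing a block of vectors by its sum does not increase the turning. -/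
theorem turning_append_sum_le (l : List V) : ∀ (U A : List V) (u : V),
    turning (A ++ (u :: U).sum :: l) ≤ turning (A ++ (u :: U) ++ l)
  | [], A, u => by simp
  | v :: U, A, u => by
    have h := turning_append_sum_le l U A (u + v)
    have h' := turning_append_add_le A u v (U ++ l)
    simp only [List.sum_cons, List.append_assoc, List.cons_append, add_assoc] at h h' ⊢
    exact h.trans h'

/-! ### Polygons and their edges -/

/-- The list of consecutive differences. -/
def diffs : List V → List V
  | [] => []
  | [_] => []
  | x :: y :: l => (y - x) :: diffs (y :: l)

/-- The exterior angles of the triangle with vertices `0`, `x`, `y`. -/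
theorem angle_add_angle_sub_left {x y : V} (h : x ≠ y) :
    angle x y + angle (y - x) y = angle (y - x) x := by
  rcases eq_or_ne y 0 with rfl | hy
  · simp only [zero_sub, angle_zero_right]
    rw [angle_neg_self_of_nonzero h]
    ring
  · have := angle_add_angle_sub_add_angle_sub_eq_pi x hy
    rw [← neg_sub y x, angle_neg_right, angle_comm x (y - x), angle_comm y (y - x)] at this
    linarith

/-- The induction carries the angle between the current edge and its initial vertex. The exterior
angle relation moves it to the endpoint of the edge, and passing to the next edge costs the angle
between the two edges. -/
theorem turning_le_angle_add_turning_diffs : ∀ (l : List V) (x y : V),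
    (x :: y :: l).IsChain (· ≠ ·) →
      turning (x :: y :: l) ≤ angle (y - x) x + turning (diffs (x :: y :: l))
  | [], x, y, h => by
    have h' := angle_add_angle_sub_left (x := x) (y := y) (by simpa using h)
    simp only [turning_cons_cons, diffs, turning_singleton]
    linarith [angle_nonneg (y - x) y]
  | z :: l, x, y, h => by
    rw [List.isChain_cons_cons] at h
    have h' := angle_add_angle_sub_left h.1
    have ih := turning_le_angle_add_turning_diffs l y z h.2
    rw [turning_cons_cons]
    simp only [diffs, turning_cons_cons] at ih ⊢
    have := angle_le_angle_add_angle (z - y) (y - x) y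
    rw [angle_comm (z - y) (y - x)] at this
    linarith

/-- A polygon turns around the origin by at most `π` more than its edges turn. -/
theorem turning_le_pi_add_turning_diffs {l : List V} (h : l.IsChain (· ≠ ·)) :
    turning l ≤ Real.pi + turning (diffs l) := by
  match l, h with
  | [], _ => simpa [diffs] using Real.pi_pos.le
  | [_], _ => simpa [diffs] using Real.pi_pos.le
  | x :: y :: l, h =>
    linarith [turning_le_angle_add_turning_diffs l x y h, angle_le_pi (y - x) x]

/-! ### Curves of bounded turning -/

/-- The turning of `f` along strictly increasing sequences in `[a, b]` is at most `C`. -/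
def TurningLE (f : ℝ → V) (a b C : ℝ) : Prop :=
  ∀ p : List ℝ, p.Pairwise (· < ·) → (∀ x ∈ p, x ∈ Set.Icc a b) → turning (p.map f) ≤ C

theorem turning_replicate_zero (n : ℕ) :
    turning (List.replicate (n + 1) (0 : V)) = n * (Real.pi / 2) := by
  induction n with
  | zero => simp
  | succ n ih =>
    rw [List.replicate_succ, List.replicate_succ, turning_cons_cons, ← List.replicate_succ, ih]
    simp
    ring

theorem pairwise_lt_map_range {x h : ℝ} (hh : 0 < h) (n : ℕ) :
    ((List.range n).map fun k : ℕ => x + k * h).Pairwise (· < ·) := by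
  rw [List.pairwise_map]
  refine List.pairwise_lt_range.imp fun {i j} hij => ?_
  have : (i : ℝ) < j := by exact_mod_cast hij
  have := mul_lt_mul_of_pos_right this hh
  linarith

theorem mem_Ico_of_mem_map_range {x y z : ℝ} {n : ℕ} (hxy : x < y)
    (hz : z ∈ (List.range n).map fun k : ℕ => x + k * ((y - x) / n)) : z ∈ Set.Ico x y := by
  obtain ⟨k, hk, rfl⟩ := List.mem_map.1 hz
  have hk : k < n := List.mem_range.1 hk
  have hn : (0 : ℝ) < n := by exact_mod_cast (Nat.zero_le k).trans_lt hk
  have hkn : (k : ℝ) < n := by exact_mod_cast hk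
  have hpos : 0 < (y - x) / n := div_pos (sub_pos.2 hxy) hn
  refine ⟨by have := mul_nonneg (Nat.cast_nonneg (α := ℝ) k) hpos.le; linarith, ?_⟩
  have := mul_lt_mul_of_pos_right hkn hpos
  rw [mul_div_cancel₀ _ hn.ne'] at this
  linarith

/-- A function of bounded turning does not vanish on an interval. -/
theorem TurningLE.exists_ne_zero {f : ℝ → V} {a b C : ℝ} (hf : TurningLE f a b C) {x y : ℝ}
    (hxy : x < y) (hx : a ≤ x) (hy : y ≤ b) : ∃ z ∈ Set.Ioo x y, f z ≠ 0 := by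
  by_contra! h
  -- Consecutive zeros cost `π / 2` each, so `n + 1` of them already exceed `C`.
  obtain ⟨n, hn⟩ := exists_nat_gt (C / (Real.pi / 2))
  rw [div_lt_iff₀ (by positivity)] at hn
  set m : ℝ := (x + y) / 2 with hm
  have hmy : m < y := by linarith
  have key := hf ((List.range (n + 1)).map fun k : ℕ => m + k * ((y - m) / (n + 1 : ℕ)))
    (pairwise_lt_map_range (div_pos (sub_pos.2 hmy) (by positivity)) _) fun z hz => by
      have := mem_Ico_of_mem_map_range hmy hz
      exact ⟨by linarith [this.1], by linarith [this.2]⟩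
  have hrep : ((List.range (n + 1)).map fun k : ℕ => m + k * ((y - m) / (n + 1 : ℕ))).map f =
      List.replicate (n + 1) 0 := by
    rw [List.eq_replicate_iff]
    refine ⟨by simp, fun v hv => ?_⟩
    obtain ⟨z, hz, rfl⟩ := List.mem_map.1 hv
    have := mem_Ico_of_mem_map_range hmy hz
    exact h z ⟨by linarith [this.1], this.2⟩
  rw [hrep, turning_replicate_zero] at key
  linarith

/-! ### Riemann sums and the turning of chords -/

/-- Left Riemann sums. -/
noncomputable def riemannSum (g : ℝ → V) (n : ℕ) (x y : ℝ) : V :=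
  ((List.range n).map fun k : ℕ => ((y - x) / n) • g (x + k * ((y - x) / n))).sum

theorem tendsto_riemannSum {f g : ℝ → V} (hf : ∀ x, HasDerivAt f (g x) x) (hg : Continuous g)
    {x y : ℝ} (hxy : x < y) :
    Tendsto (fun n => riemannSum g n x y) atTop (𝓝 (f y - f x)) := by
  have hu : UniformContinuousOn g (Set.Icc x y) :=
    isCompact_Icc.uniformContinuousOn_of_continuous hg.continuousOn
  rw [Metric.uniformContinuousOn_iff] at hu
  rw [Metric.tendsto_atTop]
  intro ε hε
  have hd : 0 < y - x := sub_pos.2 hxy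
  obtain ⟨δ, hδ, hδg⟩ := hu (ε / (2 * (y - x))) (by positivity)
  obtain ⟨N, hN⟩ := exists_nat_gt ((y - x) / δ)
  refine ⟨N + 1, fun n hn => ?_⟩
  have hn0 : (0 : ℝ) < n := by exact_mod_cast (Nat.succ_pos N).trans_le hn
  have hNn : (N : ℝ) < n := by exact_mod_cast hn
  set h : ℝ := (y - x) / n with hh
  have hhpos : 0 < h := by positivity
  have hhδ : h < δ := by
    rw [div_lt_iff₀ hδ] at hN
    rw [hh, div_lt_iff₀ hn0]
    nlinarith
  have hnh : n * h = y - x := by rw [hh]; field_simp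
  have hsum : riemannSum g n x y = ∑ k ∈ Finset.range n, h • g (x + k * h) := by
    rw [← List.toFinset_range, List.sum_toFinset _ List.nodup_range]
    rfl
  have htel : f y - f x = ∑ k ∈ Finset.range n, (f (x + (k + 1 : ℕ) * h) - f (x + k * h)) := by
    rw [Finset.sum_range_sub (fun k : ℕ => f (x + k * h))]
    simp [hnh]
  rw [dist_eq_norm, hsum, htel, ← Finset.sum_sub_distrib]
  have hterm : ∀ k ∈ Finset.range n,
      ‖h • g (x + k * h) - (f (x + (k + 1 : ℕ) * h) - f (x + k * h))‖ ≤
        ε / (2 * (y - x)) * h := by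
    intro k hk
    have hkn : ((k + 1 : ℕ) : ℝ) ≤ n := by exact_mod_cast Finset.mem_range.1 hk
    have hk1 := mul_le_mul_of_nonneg_right hkn hhpos.le
    have hk0 : 0 ≤ (k : ℝ) * h := by positivity
    push_cast at hk1 ⊢
    have hlt : x + k * h ≤ x + (k + 1) * h := by linarith
    -- The mean value inequality is applied to `f` minus its linear approximation with slope `g` at
    -- the left node.
    have hder : ∀ z ∈ Set.Icc (x + k * h) (x + (k + 1) * h),
        HasDerivWithinAt (fun z => f z - z • g (x + k * h)) (g z - g (x + k * h))
          (Set.Icc (x + k * h) (x + (k + 1) * h)) z := by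
      intro z _
      have := (hf z).fun_sub ((hasDerivAt_id z).smul_const (g (x + k * h)))
      simpa using this.hasDerivWithinAt
    have hb : ∀ z ∈ Set.Icc (x + k * h) (x + (k + 1) * h),
        ‖g z - g (x + k * h)‖ ≤ ε / (2 * (y - x)) := by
      intro z hz
      rw [← dist_eq_norm]
      refine (hδg z ⟨by linarith [hz.1], by linarith [hz.2]⟩ _ ⟨by linarith, by linarith⟩ ?_).le
      rw [Real.dist_eq, abs_lt]
      constructor <;> linarith [hz.1, hz.2]
    have := (convex_Icc (x + k * h) (x + (k + 1) * h)).norm_image_sub_le_of_norm_hasDerivWithin_le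
      hder hb (Set.left_mem_Icc.2 hlt) (Set.right_mem_Icc.2 hlt)
    rw [norm_sub_rev]
    calc _ = ‖f (x + (k + 1) * h) - (x + (k + 1) * h) • g (x + k * h) -
            (f (x + k * h) - (x + k * h) • g (x + k * h))‖ := by
          congr 1
          module
      _ ≤ _ := this
      _ = _ := by
          rw [Real.norm_eq_abs, show x + (k + 1) * h - (x + k * h) = h by ring, abs_of_pos hhpos]
  calc _ ≤ ∑ k ∈ Finset.range n, ε / (2 * (y - x)) * h :=
        (norm_sum_le _ _).trans (Finset.sum_le_sum hterm)
    _ = ε / 2 := by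
        rw [Finset.sum_const, Finset.card_range, nsmul_eq_mul]
        rw [show (n : ℝ) * (ε / (2 * (y - x)) * h) = ε / (2 * (y - x)) * (n * h) by ring, hnh]
        field_simp
    _ < ε := by linarith

/-- The Riemann sums of `g` over the consecutive intervals of a list. -/
noncomputable def riemannSums (g : ℝ → V) (n : ℕ) : List ℝ → List V
  | [] => []
  | [_] => []
  | x :: y :: l => riemannSum g n x y :: riemannSums g n (y :: l)

/-- The nodes of the Riemann sums over the consecutive intervals of a list. -/
noncomputable def riemannNodes (n : ℕ) : List ℝ → List ℝ
  | [] => []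
  | [_] => []
  | x :: y :: l =>
    ((List.range n).map fun k : ℕ => x + k * ((y - x) / n)) ++ riemannNodes n (y :: l)

theorem mem_riemannNodes (n : ℕ) : ∀ (l : List ℝ) (x b : ℝ), (x :: l).Pairwise (· < ·) →
    (∀ z ∈ x :: l, z ≤ b) → ∀ z ∈ riemannNodes n (x :: l), z ∈ Set.Icc x b
  | [], x, b, _, _, z, hz => by simp [riemannNodes] at hz
  | y :: l, x, b, hl, hb, z, hz => by
    rw [List.pairwise_cons] at hl
    have hxy : x < y := hl.1 y (by simp)
    have hyb : y ≤ b := hb y (by simp)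
    rw [riemannNodes, List.mem_append] at hz
    rcases hz with hz | hz
    · have := mem_Ico_of_mem_map_range hxy hz
      exact ⟨this.1, by linarith [this.2]⟩
    · have := mem_riemannNodes n l y b hl.2 (fun z hz => hb z (List.mem_cons_of_mem _ hz)) z hz
      exact ⟨by linarith [this.1], this.2⟩

theorem pairwise_riemannNodes {n : ℕ} (hn : n ≠ 0) : ∀ (l : List ℝ),
    l.Pairwise (· < ·) → (riemannNodes n l).Pairwise (· < ·)
  | [], _ => by simp [riemannNodes]
  | [x], _ => by simp [riemannNodes]
  | x :: y :: l, hl => by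
    rw [List.pairwise_cons] at hl
    have hxy : x < y := hl.1 y (by simp)
    rw [riemannNodes, List.pairwise_append]
    refine ⟨pairwise_lt_map_range (div_pos (sub_pos.2 hxy) (by positivity)) _,
      pairwise_riemannNodes hn _ hl.2, fun z hz w hw => ?_⟩
    have h₁ := mem_Ico_of_mem_map_range hxy hz
    obtain ⟨b, hb⟩ := (y :: l).toFinset.finite_toSet.bddAbove
    have h₂ := mem_riemannNodes n l y b hl.2 (fun z hz => hb (by simpa using hz)) w hw
    exact h₁.2.trans_le h₂.1

/-- The vectors `r i • v i` with positive `r i` turn as much as the vectors `v i`. -/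
theorem turning_eq_of_forall₂ {l l' : List V}
    (h : List.Forall₂ (fun u v => ∃ r : ℝ, 0 < r ∧ u = r • v) l l') : turning l = turning l' := by
  induction h with
  | nil => rfl
  | cons h₁ t ih =>
    cases t with
    | nil => simp
    | cons h₂ t =>
      obtain ⟨r, hr, rfl⟩ := h₁
      obtain ⟨r', hr', rfl⟩ := h₂
      simp only [turning_cons_cons] at ih ⊢
      rw [ih, angle_smul_left_of_pos _ _ hr, angle_smul_right_of_pos _ _ hr']

/-- The weighted values of `g` whose partial sums are the Riemann sums. -/
noncomputable def riemannTerms (g : ℝ → V) (n : ℕ) : List ℝ → List V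
  | [] => []
  | [_] => []
  | x :: y :: l =>
    ((List.range n).map fun k : ℕ => ((y - x) / n) • g (x + k * ((y - x) / n))) ++
      riemannTerms g n (y :: l)

theorem turning_riemannTerms (g : ℝ → V) {n : ℕ} (hn : n ≠ 0) (l : List ℝ)
    (hl : l.Pairwise (· < ·)) :
    turning (riemannTerms g n l) = turning ((riemannNodes n l).map g) := by
  refine turning_eq_of_forall₂ ?_
  induction l with
  | nil => simp [riemannTerms, riemannNodes]
  | cons x l ih =>
    cases l with
    | nil => simp [riemannTerms, riemannNodes]
    | cons y l =>
      rw [List.pairwise_cons] at hl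
      have hxy : x < y := hl.1 y (by simp)
      rw [riemannTerms, riemannNodes, List.map_append]
      refine List.rel_append ?_ (ih hl.2)
      rw [List.map_map, List.forall₂_map_left_iff, List.forall₂_map_right_iff]
      exact List.forall₂_same.2 fun k _ => ⟨_, div_pos (sub_pos.2 hxy) (by positivity), rfl⟩

theorem turning_append_riemannSums_le (g : ℝ → V) {n : ℕ} (hn : n ≠ 0) : ∀ (l : List ℝ)
    (A : List V), turning (A ++ riemannSums g n l) ≤ turning (A ++ riemannTerms g n l)
  | [], A => by simp [riemannSums, riemannTerms]
  | [_], A => by simp [riemannSums, riemannTerms]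
  | x :: y :: l, A => by
    rw [riemannSums, riemannTerms, riemannSum]
    -- The block must be nonempty for `turning_append_sum_le`. Blocks already expanded accumulate in
    -- the prefix `A`.
    obtain ⟨n, rfl⟩ := Nat.exists_eq_succ_of_ne_zero hn
    generalize hU : ((List.range (n + 1)).map fun k : ℕ =>
      ((y - x) / (n + 1 : ℕ)) • g (x + k * ((y - x) / (n + 1 : ℕ)))) = U
    cases U with
    | nil => simp at hU
    | cons u U =>
      refine (turning_append_sum_le _ U A u).trans ?_
      rw [← List.append_assoc]
      exact turning_append_riemannSums_le g hn (y :: l) (A ++ u :: U)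

/-- The angle is continuous only away from zero vectors, which is why consecutive values of `f` have
to differ. -/
theorem tendsto_turning_riemannSums {f g : ℝ → V} (hf : ∀ x, HasDerivAt f (g x) x)
    (hg : Continuous g) : ∀ l : List ℝ, l.Pairwise (· < ·) → (l.map f).IsChain (· ≠ ·) →
      Tendsto (fun n => turning (riemannSums g n l)) atTop (𝓝 (turning (diffs (l.map f))))
  | [], _, _ => by simp [riemannSums, diffs]
  | [x], _, _ => by simp [riemannSums, diffs]
  | [x, y], _, _ => by simp [riemannSums, diffs]
  | x :: y :: z :: l, hl, hc => by
    have hl' := List.pairwise_cons.1 hl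
    have hl'' := List.pairwise_cons.1 hl'.2
    have ih := tendsto_turning_riemannSums hf hg (y :: z :: l) hl'.2
      (by simp only [List.map_cons, List.isChain_cons_cons] at hc ⊢; exact hc.2)
    simp only [List.map_cons, List.isChain_cons_cons] at hc
    have h₁ := tendsto_riemannSum hf hg (hl'.1 y (by simp))
    have h₂ := tendsto_riemannSum hf hg (hl''.1 z (by simp))
    simp only [riemannSums, List.map_cons, diffs, turning_cons_cons] at ih ⊢
    refine Tendsto.add ?_ ih
    have := (continuousAt_angle (x := (f y - f x, f z - f y)) (sub_ne_zero.2 hc.1.symm)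
      (sub_ne_zero.2 hc.2.1.symm)).tendsto.comp (h₁.prodMk_nhds h₂)
    exact this

/-- A sequence of nodes can be refined so that consecutive values of `f` are distinct. -/
theorem exists_refinement_isChain_ne {f : ℝ → V} {a b : ℝ}
    (hf : ∀ x y, x < y → a ≤ x → y ≤ b → ∃ z ∈ Set.Ioo x y, f z ≠ f x) : ∀ (l : List ℝ) (x : ℝ),
    (x :: l).Pairwise (· < ·) → (∀ z ∈ x :: l, z ∈ Set.Icc a b) →
      ∃ q : List ℝ, (x :: q).Pairwise (· < ·) ∧ (∀ z ∈ x :: q, z ∈ Set.Icc a b) ∧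
        ((x :: q).map f).IsChain (· ≠ ·) ∧
          turning ((x :: l).map f) ≤ turning ((x :: q).map f)
  | [], x, hl, hb => ⟨[], hl, hb, by simp, le_rfl⟩
  | y :: l, x, hl, hb => by
    have hl' := List.pairwise_cons.1 hl
    have hxy : x < y := hl'.1 y (by simp)
    have hxb := hb x (by simp)
    have hyb := hb y (by simp)
    obtain ⟨q, hq, hqb, hqc, hqt⟩ := exists_refinement_isChain_ne hf l y hl'.2
      fun z hz => hb z (List.mem_cons_of_mem _ hz)
    have hyq : ∀ w ∈ y :: q, y ≤ w := by
      intro w hw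
      rcases List.mem_cons.1 hw with rfl | hw
      · exact le_rfl
      · exact ((List.pairwise_cons.1 hq).1 w hw).le
    simp only [List.map_cons] at hqc hqt ⊢
    by_cases hfxy : f x = f y
    · obtain ⟨r, hr, hfr⟩ := hf x y hxy hxb.1 hyb.2
      refine ⟨r :: y :: q, ?_, ?_, ?_, ?_⟩
      · rw [List.pairwise_cons, List.pairwise_cons]
        refine ⟨fun w hw => ?_, fun w hw => hr.2.trans_le (hyq w hw), hq⟩
        rcases List.mem_cons.1 hw with rfl | hw
        · exact hr.1
        · exact hxy.trans_le (hyq w hw)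
      · intro w hw
        rcases List.mem_cons.1 hw with rfl | hw
        · exact hxb
        rcases List.mem_cons.1 hw with rfl | hw
        · exact ⟨hxb.1.trans hr.1.le, hr.2.le.trans hyb.2⟩
        · exact hqb w hw
      · simp only [List.map_cons, List.isChain_cons_cons]
        exact ⟨hfr.symm, by rwa [← hfxy], hqc⟩
      · simp only [List.map_cons, turning_cons_cons]
        linarith [angle_le_angle_add_angle (f x) (f r) (f y)]
    · refine ⟨y :: q, ?_, ?_, ?_, ?_⟩
      · rw [List.pairwise_cons]
        exact ⟨fun w hw => hxy.trans_le (hyq w hw), hq⟩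
      · intro w hw
        rcases List.mem_cons.1 hw with rfl | hw
        · exact hxb
        · exact hqb w hw
      · simp only [List.map_cons, List.isChain_cons_cons]
        exact ⟨hfxy, hqc⟩
      · simp only [List.map_cons, turning_cons_cons]
        linarith

/-- Rolle's theorem for turning: a curve turns around the origin by at most `π` more than its
velocity does. -/
theorem TurningLE.of_hasDerivAt {f g : ℝ → V} (hf : ∀ x, HasDerivAt f (g x) x)
    (hg : Continuous g) {a b C : ℝ} (hC : TurningLE g a b C) :
    TurningLE f a b (C + Real.pi) := by
  -- If `f` were constant on an interval, `g` would vanish there, against its bounded turning.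
  have hne : ∀ x y, x < y → a ≤ x → y ≤ b → ∃ z ∈ Set.Ioo x y, f z ≠ f x := by
    intro x y hxy hx hy
    by_contra! h
    obtain ⟨z, hz, hgz⟩ := hC.exists_ne_zero hxy hx hy
    refine hgz ((hf z).unique ?_)
    refine (hasDerivAt_const z (f x)).congr_of_eventuallyEq ?_
    filter_upwards [Ioo_mem_nhds hz.1 hz.2] with w hw using h w hw
  intro p hp hpb
  cases p with
  | nil =>
    have := hC [] (by simp) (by simp)
    simp only [List.map_nil, turning_nil] at this ⊢
    linarith [Real.pi_pos]
  | cons x p =>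
    obtain ⟨q, hq, hqb, hqc, hqt⟩ := exists_refinement_isChain_ne hne p x hp hpb
    have h₁ := turning_le_pi_add_turning_diffs hqc
    have h₂ : turning (diffs ((x :: q).map f)) ≤ C := by
      refine le_of_tendsto (tendsto_turning_riemannSums hf hg _ hq hqc) ?_
      filter_upwards [eventually_ne_atTop 0] with n hn
      refine (turning_append_riemannSums_le g hn (x :: q) []).trans ?_
      rw [List.nil_append, turning_riemannTerms g hn _ hq]
      refine hC _ (pairwise_riemannNodes hn _ hq) fun z hz => ?_
      have := mem_riemannNodes n q x b hq (fun z hz => (hqb z hz).2) z hz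
      exact ⟨(hqb x (by simp)).1.trans this.1, this.2⟩
    linarith

/-! ### Counting zeros by turning -/

/-- Each zero contributes `π` to the turning. -/
theorem TurningLE.exists_interlacing {f : ℝ → V} {a b C : ℝ} (hf : TurningLE f a b C) :
    ∀ (l : List ℝ) (x : ℝ), f x ≠ 0 → (x :: l).Pairwise (· < ·) → a ≤ x → x ≤ b →
      (∀ z ∈ l, z < b ∧ f z = 0) →
      ∃ q : List ℝ, (x :: q).Pairwise (· < ·) ∧ (∀ z ∈ x :: q, z ≤ b) ∧
        l.length * Real.pi ≤ turning ((x :: q).map f)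
  | [], x, _, _, _, hb, _ => ⟨[], by simp, by simpa using hb, by simp⟩
  | z :: l, x, hx, hl, ha, hb, hz => by
    have hl' := List.pairwise_cons.1 hl
    have hl'' := List.pairwise_cons.1 hl'.2
    have hxz : x < z := hl'.1 z (by simp)
    have hz0 := hz z (by simp)
    -- Here `c` is the next zero, or `b` after the last one. A point between `z` and `c` with
    -- nonzero value makes the path leave the origin, so `z` costs `π / 2` on each side.
    obtain ⟨c, hzc, hcb, hcl⟩ : ∃ c, z < c ∧ c ≤ b ∧ ∀ w ∈ l, c ≤ w := by
      cases l with
      | nil => exact ⟨b, hz0.1, le_rfl, by simp⟩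
      | cons w l =>
        refine ⟨w, hl''.1 w (by simp), (hz w (by simp)).1.le, fun v hv => ?_⟩
        rcases List.mem_cons.1 hv with rfl | hv
        · exact le_rfl
        · exact ((List.pairwise_cons.1 hl''.2).1 v hv).le
    obtain ⟨y, hy, hfy⟩ := hf.exists_ne_zero hzc (ha.trans hxz.le) hcb
    obtain ⟨q, hq, hqb, hqt⟩ := hf.exists_interlacing l y hfy
      (List.pairwise_cons.2 ⟨fun w hw => hy.2.trans_le (hcl w hw), hl''.2⟩)
      ((ha.trans hxz.le).trans hy.1.le) (hy.2.le.trans hcb)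
      fun w hw => hz w (List.mem_cons_of_mem _ hw)
    have hyq : ∀ w ∈ y :: q, z < w := by
      intro w hw
      rcases List.mem_cons.1 hw with rfl | hw
      · exact hy.1
      · exact hy.1.trans ((List.pairwise_cons.1 hq).1 w hw)
    refine ⟨z :: y :: q, ?_, ?_, ?_⟩
    · rw [List.pairwise_cons, List.pairwise_cons]
      refine ⟨fun w hw => ?_, hyq, hq⟩
      rcases List.mem_cons.1 hw with rfl | hw
      · exact hxz
      · exact hxz.trans (hyq w hw)
    · intro w hw
      rcases List.mem_cons.1 hw with rfl | hw
      · exact hb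
      rcases List.mem_cons.1 hw with rfl | hw
      · exact hz0.1.le
      · exact hqb w hw
    · simp only [List.map_cons, turning_cons_cons, hz0.2, angle_zero_left, angle_zero_right,
        List.length_cons, Nat.cast_add, Nat.cast_one] at hqt ⊢
      linarith

/-- The number of zeros is bounded by the turning. -/
theorem TurningLE.card_zeros_le {f : ℝ → V} {a b C : ℝ} (hf : TurningLE f a b C) (hab : a < b)
    (Z : Finset ℝ) (hZ : ∀ z ∈ Z, z ∈ Set.Ioo a b ∧ f z = 0) : Z.card * Real.pi ≤ C := by
  obtain ⟨c, hac, hcb, hcZ⟩ : ∃ c, a < c ∧ c ≤ b ∧ ∀ z ∈ Z, c ≤ z := by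
    rcases Z.eq_empty_or_nonempty with rfl | hne
    · exact ⟨b, hab, le_rfl, by simp⟩
    · have := hZ _ (Z.min'_mem hne)
      exact ⟨Z.min' hne, this.1.1, this.1.2.le, fun z hz => Z.min'_le z hz⟩
  obtain ⟨x, hx, hfx⟩ := hf.exists_ne_zero hac le_rfl hcb
  obtain ⟨q, hq, hqb, hqt⟩ := hf.exists_interlacing Z.sort x hfx
    (List.pairwise_cons.2 ⟨fun z hz => hx.2.trans_le (hcZ z (by simpa using hz)),
      Z.sortedLT_sort.pairwise⟩) hx.1.le (hx.2.le.trans hcb)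
    fun z hz => by
      have := hZ z (by simpa using hz)
      exact ⟨this.1.2, this.2⟩
  rw [Finset.length_sort] at hqt
  refine hqt.trans (hf _ hq fun z hz => ⟨?_, hqb z hz⟩)
  rcases List.mem_cons.1 hz with rfl | hz
  · exact hx.1.le
  · exact (hx.1.trans ((List.pairwise_cons.1 hq).1 z hz)).le

end Turning

end SpikePhase

namespace SpikePhase

open InnerProductGeometry

/-! ### Turning and zeros of exponential sums -/

section ExponentialSums

theorem angle_self_exp_mul_le {v : ℂ} (hv : v ≠ 0) (γ : ℝ) :
    angle v (Complex.exp (γ * Complex.I) * v) ≤ |γ| := by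
  have h := Complex.angle_mul_right hv 1 (Complex.exp (γ * Complex.I))
  rw [one_mul] at h
  rw [h, Complex.angle_one_left (Complex.exp_ne_zero _)]
  rcases le_or_gt |γ| Real.pi with hγ | hγ
  -- The principal argument takes values in `(-π, π]`, so `γ = -π` is treated apart.
  · rcases eq_or_ne γ (-Real.pi) with rfl | hne
    · refine (Complex.abs_arg_le_pi _).trans ?_
      rw [abs_neg, abs_of_pos Real.pi_pos]
    · rw [Complex.arg_exp_mul_I, (toIocMod_eq_self _).2]
      rw [abs_le] at hγ
      exact ⟨lt_of_le_of_ne hγ.1 hne.symm, by linarith⟩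
  · exact (Complex.abs_arg_le_pi _).trans hγ.le

theorem angle_exp_mul_exp_mul_le (α β : ℝ) (u v : ℂ) :
    angle (Complex.exp (α * Complex.I) * u) (Complex.exp (β * Complex.I) * v) ≤
      angle u v + |β - α| := by
  rcases eq_or_ne v 0 with rfl | hv
  · simp
  have h : Complex.exp (β * Complex.I) * v =
      Complex.exp (α * Complex.I) * (Complex.exp ((β - α : ℝ) * Complex.I) * v) := by
    rw [← mul_assoc, ← Complex.exp_add]
    congr 2
    push_cast
    ring
  rw [h, Complex.angle_mul_left (Complex.exp_ne_zero _)]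
  exact (angle_le_angle_add_angle u v _).trans (by gcongr; exact angle_self_exp_mul_le hv _)

theorem turning_exp_mul_le (f : ℝ → ℂ) {β b : ℝ} (hβ : 0 ≤ β) : ∀ (l : List ℝ) (x : ℝ),
    (x :: l).Pairwise (· < ·) → (∀ z ∈ x :: l, z ≤ b) →
      turning ((x :: l).map fun x => Complex.exp ((β * x : ℝ) * Complex.I) * f x) ≤
        turning ((x :: l).map f) + β * (b - x)
  | [], x, _, hb => by
    have : x ≤ b := hb x (by simp)
    simpa using mul_nonneg hβ (sub_nonneg.2 this)
  | y :: l, x, hl, hb => by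
    have hl' := List.pairwise_cons.1 hl
    have hxy : x < y := hl'.1 y (by simp)
    have ih := turning_exp_mul_le f hβ l y hl'.2 fun z hz => hb z (List.mem_cons_of_mem _ hz)
    have h := angle_exp_mul_exp_mul_le (β * x) (β * y) (f x) (f y)
    rw [← mul_sub, abs_of_nonneg (mul_nonneg hβ (sub_nonneg.2 hxy.le))] at h
    simp only [List.map_cons, turning_cons_cons] at ih ⊢
    linarith

/-- Modulating by a frequency `β` increases the turning on `[a, b]` by at most `β (b - a)`. -/
theorem TurningLE.exp_mul {f : ℝ → ℂ} {a b C β : ℝ} (hf : TurningLE f a b C) (hβ : 0 ≤ β)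
    (hab : a ≤ b) :
    TurningLE (fun x => Complex.exp ((β * x : ℝ) * Complex.I) * f x) a b (C + β * (b - a)) := by
  intro p hp hpb
  cases p with
  | nil =>
    have := hf [] (by simp) (by simp)
    simp only [List.map_nil, turning_nil] at this ⊢
    linarith [mul_nonneg hβ (sub_nonneg.2 hab)]
  | cons x p =>
    have h₁ := turning_exp_mul_le f hβ p x hp fun z hz => (hpb z hz).2
    have h₂ := hf _ hp hpb
    have h₃ := mul_le_mul_of_nonneg_left (hpb x (by simp)).1 hβ
    linarith

theorem turningLE_const {c : ℂ} (hc : c ≠ 0) (a b : ℝ) : TurningLE (fun _ => c) a b 0 := by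
  intro p hp hpb
  clear hp hpb
  induction p with
  | nil => simp
  | cons x p ih =>
    cases p with
    | nil => simp
    | cons y p =>
      simp only [List.map_cons, turning_cons_cons, angle_self hc] at ih ⊢
      linarith

/-- The exponential sum `x ↦ ∑ i ∈ s, c i * exp (I * lam i * x)`. -/
noncomputable def expSum {ι : Type*} (s : Finset ι) (c : ι → ℂ) (lam : ι → ℝ) (x : ℝ) : ℂ :=
  ∑ i ∈ s, c i * Complex.exp ((lam i * x : ℝ) * Complex.I)

theorem hasDerivAt_expSum {ι : Type*} (s : Finset ι) (c : ι → ℂ) (lam : ι → ℝ) (x : ℝ) :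
    HasDerivAt (expSum s c lam) (expSum s (fun i => c i * (lam i * Complex.I)) lam x) x := by
  unfold expSum
  refine HasDerivAt.fun_sum fun i _ => ?_
  have h₁ : HasDerivAt (fun x : ℝ => ((lam i * x : ℝ) : ℂ) * Complex.I) (lam i * Complex.I) x := by
    have := (((hasDerivAt_id x).const_mul (lam i)).ofReal_comp).mul_const Complex.I
    simpa using this
  have := (h₁.cexp).const_mul (c i)
  exact this.congr_deriv (by ring)

theorem continuous_expSum {ι : Type*} (s : Finset ι) (c : ι → ℂ) (lam : ι → ℝ) :
    Continuous (expSum s c lam) := by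
  unfold expSum
  fun_prop

/-- The turning of an exponential sum with `k + 1` frequencies in `[0, β]`. -/
theorem turningLE_expSum {ι : Type*} {a b : ℝ} (hab : a ≤ b) : ∀ (k : ℕ) (s : Finset ι)
    (c : ι → ℂ) (lam : ι → ℝ) (β : ℝ), s.card = k + 1 → (∀ i ∈ s, c i ≠ 0) →
      Set.InjOn lam s → (∀ i ∈ s, lam i ∈ Set.Icc 0 β) →
        TurningLE (expSum s c lam) a b (k * Real.pi + β * (b - a)) := by
  classical
  intro k
  induction k with
  | zero =>
    intro s c lam β hs hc _ hβ
    obtain ⟨i, rfl⟩ := Finset.card_eq_one.1 (by simpa using hs)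
    have hi := hβ i (by simp)
    have h := (turningLE_const (hc i (by simp)) a b).exp_mul hi.1 hab
    have heq : expSum {i} c lam = fun x => Complex.exp ((lam i * x : ℝ) * Complex.I) * c i := by
      funext x
      simp [expSum, mul_comm]
    rw [heq]
    intro p hp hpb
    refine (h p hp hpb).trans ?_
    have := mul_le_mul_of_nonneg_right hi.2 (sub_nonneg.2 hab)
    simpa using this
  | succ k ih =>
    intro s c lam β hs hc hinj hβ
    -- With the lowest frequency `lam i` divided out, term `i` is constant and differentiation
    -- removes it. The costs are `β - lam i` per unit length from the induction, `π` from Rolle, and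
    -- `lam i` per unit length for restoring the factor.
    obtain ⟨i, his, hmin⟩ := s.exists_min_image lam (Finset.card_pos.1 (by omega))
    have hi := hβ i his
    set lam' : ι → ℝ := fun j => lam j - lam i with hlam'
    have heq : expSum s c lam =
        fun x => Complex.exp ((lam i * x : ℝ) * Complex.I) * expSum s c lam' x := by
      funext x
      simp only [expSum, Finset.mul_sum]
      refine Finset.sum_congr rfl fun j _ => ?_
      rw [mul_left_comm, ← Complex.exp_add]
      congr 2
      simp only [hlam']
      push_cast
      ring
    have hder : expSum s (fun j => c j * (lam' j * Complex.I)) lam' =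
        expSum (s.erase i) (fun j => c j * (lam' j * Complex.I)) lam' := by
      funext x
      simp only [expSum]
      rw [← Finset.add_sum_erase s _ his]
      simp [hlam']
    have hIH := ih (s.erase i) (fun j => c j * (lam' j * Complex.I)) lam' (β - lam i)
      (by rw [Finset.card_erase_of_mem his]; omega)
      (fun j hj => by
        rw [Finset.mem_erase] at hj
        have hne : lam' j ≠ 0 := fun h => hj.1 (hinj hj.2 his (sub_eq_zero.1 h))
        exact mul_ne_zero (hc j hj.2)
          (mul_ne_zero (Complex.ofReal_ne_zero.2 hne) Complex.I_ne_zero))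
      (fun j hj j' hj' h => hinj (Finset.mem_of_mem_erase hj) (Finset.mem_of_mem_erase hj')
        (sub_left_injective h))
      (fun j hj => by
        have hj := Finset.mem_of_mem_erase hj
        exact ⟨sub_nonneg.2 (hmin j hj), sub_le_sub_right (hβ j hj).2 _⟩)
    rw [← hder] at hIH
    have h := (hIH.of_hasDerivAt (hasDerivAt_expSum s c lam') (continuous_expSum _ _ _)).exp_mul
      hi.1 hab
    rw [heq]
    intro p hp hpb
    refine (h p hp hpb).trans (le_of_eq ?_)
    push_cast
    ring

/-- An exponential sum with `m` frequencies in `[0, β]` and more than `m` zeros in `[-R, R]`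
vanishes identically if `β R < π`. -/
theorem expSum_coeff_eq_zero {ι : Type*} (s : Finset ι) (c : ι → ℂ) (lam : ι → ℝ) {β R : ℝ}
    (hβ : 0 < β) (hR : 0 < R) (hβR : β * R < Real.pi) (hinj : Set.InjOn lam s)
    (hlam : ∀ i ∈ s, lam i ∈ Set.Icc 0 β) (Z : Finset ℝ)
    (hZ : ∀ z ∈ Z, z ∈ Set.Icc (-R) R ∧ expSum s c lam z = 0) (hcard : s.card < Z.card) :
    ∀ i ∈ s, c i = 0 := by
  classical
  by_contra! hne
  obtain ⟨i, his, hci⟩ := hne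
  set t := s.filter fun i => c i ≠ 0 with ht
  have hit : i ∈ t := Finset.mem_filter.2 ⟨his, hci⟩
  have hts : t ⊆ s := Finset.filter_subset _ _
  have heq : expSum s c lam = expSum t c lam := by
    funext x
    refine (Finset.sum_subset hts fun j hj hjt => ?_).symm
    have : c j = 0 := by
      by_contra h
      exact hjt (Finset.mem_filter.2 ⟨hj, h⟩)
    simp [this]
  obtain ⟨k, hk⟩ : ∃ k, t.card = k + 1 :=
    Nat.exists_eq_succ_of_ne_zero (Finset.card_pos.2 ⟨i, hit⟩).ne'
  set R' : ℝ := Real.pi / β with hR'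
  have hRR' : R < R' := by rwa [hR', lt_div_iff₀ hβ, mul_comm]
  -- A radius strictly between `R` and `π / β` makes zeros at `±R` interior while keeping `β * r <
  -- π`.
  set r : ℝ := (R + R') / 2 with hr
  have hT := turningLE_expSum (a := -r) (b := r) (by linarith) k t c lam β hk
    (fun j hj => (Finset.mem_filter.1 hj).2) (hinj.mono hts) fun j hj => hlam j (hts hj)
  have hcz := hT.card_zeros_le (by linarith) Z fun z hz => by
    have := hZ z hz
    exact ⟨⟨by linarith [this.1.1], by linarith [this.1.2]⟩, by rw [← heq]; exact this.2⟩
  have hβr : β * r < Real.pi := by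
    have : r < R' := by linarith
    rwa [hR', lt_div_iff₀ hβ, mul_comm] at this
  have hkZ : k + 2 ≤ Z.card := by
    have := Finset.card_le_card hts
    omega
  have hkZ' : (k : ℝ) + 2 ≤ Z.card := by exact_mod_cast hkZ
  nlinarith [mul_le_mul_of_nonneg_right hkZ' Real.pi_pos.le]

end ExponentialSums

/-! ### Uniqueness for sparse measures -/

section Measures

/-- A combination of Dirac measures with `s` nodes in `[0, Λ]`, indexed by a set of nodes. -/
theorem exists_finset_of_mem_sparseMeasures {Λ : ℝ} {s : ℕ} {μ : ComplexMeasure ℝ}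
    (hμ : μ ∈ sparseMeasures Λ s) : ∃ (T : Finset ℝ) (c : ℝ → ℂ), T.card ≤ s ∧
      (∀ t ∈ T, t ∈ Set.Icc 0 Λ) ∧ (∀ t ∉ T, c t = 0) ∧ μ = ∑ t ∈ T, c t • diracC t := by
  classical
  obtain ⟨c, t, ht, htΛ, rfl⟩ := hμ
  refine ⟨Finset.univ.image t, Function.extend t c 0, ?_, ?_, ?_, ?_⟩
  · simpa using Finset.card_image_le (s := Finset.univ) (f := t)
  · intro x hx
    obtain ⟨j, _, rfl⟩ := Finset.mem_image.1 hx
    exact htΛ j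
  · intro x hx
    rw [Function.extend_apply' _ _ _ (fun ⟨j, hj⟩ =>
      hx (Finset.mem_image.2 ⟨j, Finset.mem_univ _, hj⟩))]
    rfl
  · rw [Finset.sum_image fun _ _ _ _ h => ht.injective h]
    simp [ht.injective.extend_apply]

theorem fourierC_finset_sum_dirac (T : Finset ℝ) (c : ℝ → ℂ) (ω : ℝ) :
    fourierC (∑ t ∈ T, c t • diracC t) ω = expSum T c (fun t => 2 * Real.pi * t) (-ω) := by
  have h := fourierC_sum_dirac (fun j => c (T.equivFin.symm j)) (fun j => T.equivFin.symm j) ω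
  have e₁ : ∑ j, c (T.equivFin.symm j) • diracC (T.equivFin.symm j) = ∑ t ∈ T, c t • diracC t := by
    rw [T.equivFin.symm.sum_comp fun t : T => c t • diracC t, Finset.sum_coe_sort T
      fun t => c t • diracC t]
  rw [e₁] at h
  rw [h, T.equivFin.symm.sum_comp fun t : T =>
    c t * Complex.exp (-(2 * Real.pi * Complex.I * ω * (t : ℝ))),
    Finset.sum_coe_sort T fun t => c t * Complex.exp (-(2 * Real.pi * Complex.I * ω * t))]
  refine Finset.sum_congr rfl fun t _ => ?_
  congr 2
  push_cast
  ring

/-- Two sparse measures whose Fourier transforms are proportional at more than `2 s` points of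
`[-Ω, Ω]` are proportional. -/
theorem eq_smul_of_fourierC_eq {s : ℕ} {Ω Λ : ℝ} (hΩ : 0 < Ω) (hΛ : 0 < Λ)
    (hΩΛ : Ω * Λ < 1 / 2) {μ ν : ComplexMeasure ℝ} (hμ : μ ∈ sparseMeasures Λ s)
    (hν : ν ∈ sparseMeasures Λ s) (u : ℂ) (W : Finset ℝ) (hW : ∀ w ∈ W, w ∈ Set.Icc (-Ω) Ω)
    (hcard : 2 * s < W.card) (h : ∀ w ∈ W, fourierC ν w = u * fourierC μ w) : ν = u • μ := by
  classical
  obtain ⟨S, c, hS, hSΛ, hSc, rfl⟩ := exists_finset_of_mem_sparseMeasures hμ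
  obtain ⟨T, d, hT, hTΛ, hTd, rfl⟩ := exists_finset_of_mem_sparseMeasures hν
  -- Both sums are rewritten over the common node set `S ∪ T`. A general `F` serves the exponential
  -- sums and the measures alike.
  have eS : ∀ {M : Type} [AddCommMonoid M] (F : ℂ → ℝ → M), (∀ t, F 0 t = 0) →
      ∑ t ∈ S, F (c t) t = ∑ t ∈ S ∪ T, F (c t) t := fun F hF =>
    Finset.sum_subset Finset.subset_union_left fun t _ ht => by rw [hSc t ht, hF]
  have eT : ∀ {M : Type} [AddCommMonoid M] (F : ℂ → ℝ → M), (∀ t, F 0 t = 0) →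
      ∑ t ∈ T, F (d t) t = ∑ t ∈ S ∪ T, F (d t) t := fun F hF =>
    Finset.sum_subset Finset.subset_union_right fun t _ ht => by rw [hTd t ht, hF]
  have key := expSum_coeff_eq_zero (S ∪ T) (fun t => d t - u * c t) (fun t => 2 * Real.pi * t)
    (β := 2 * Real.pi * Λ) (R := Ω) (by positivity) hΩ (by nlinarith [Real.pi_pos])
    (fun x _ y _ hxy => mul_left_cancel₀ (by positivity : 2 * Real.pi ≠ 0) hxy)
    (fun t ht => by
      have : t ∈ Set.Icc 0 Λ := (Finset.mem_union.1 ht).elim (hSΛ t) (hTΛ t)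
      exact ⟨mul_nonneg (by positivity) this.1, mul_le_mul_of_nonneg_left this.2 (by positivity)⟩)
    -- The sign of the transform goes into the argument, so that the frequencies `2πt` lie in `[0,
    -- 2πΛ]`.
    (W.image Neg.neg)
    (fun z hz => by
      obtain ⟨w, hw, rfl⟩ := Finset.mem_image.1 hz
      have hwΩ := hW w hw
      refine ⟨⟨by linarith [hwΩ.2], by linarith [hwΩ.1]⟩, ?_⟩
      have hw' := h w hw
      rw [fourierC_finset_sum_dirac, fourierC_finset_sum_dirac] at hw'
      simp only [expSum] at hw' ⊢
      rw [eS (fun c t => c * Complex.exp ((2 * Real.pi * t * -w : ℝ) * Complex.I)) (by simp),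
        eT (fun c t => c * Complex.exp ((2 * Real.pi * t * -w : ℝ) * Complex.I)) (by simp)] at hw'
      simp only [sub_mul, Finset.sum_sub_distrib, mul_assoc u, ← Finset.mul_sum]
      rw [hw', sub_self])
    (by
      rw [Finset.card_image_of_injective _ neg_injective]
      have := Finset.card_union_le S T
      omega)
  rw [eS (fun c t => c • diracC t) fun t => zero_smul ℂ (diracC t),
    eT (fun c t => c • diracC t) fun t => zero_smul ℂ (diracC t),
    Finset.smul_sum]
  refine Finset.sum_congr rfl fun t ht => ?_
  rw [smul_smul, sub_eq_zero.1 (key t ht)]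

end Measures

/-! ### Propagating the phase along the graph -/

section PhaseRetrieval

/-- The moduli `|z|`, `|w|`, `|z - w|`, `|z - i w|` determine `z * conj w`. -/
theorem mul_conj_eq_of_norm_sq_eq {z w z' w' : ℂ} (hz : ‖z‖ ^ 2 = ‖z'‖ ^ 2)
    (hw : ‖w‖ ^ 2 = ‖w'‖ ^ 2) (h₁ : ‖z - w‖ ^ 2 = ‖z' - w'‖ ^ 2)
    (h₂ : ‖z - Complex.I * w‖ ^ 2 = ‖z' - Complex.I * w'‖ ^ 2) :
    z * (starRingEnd ℂ) w = z' * (starRingEnd ℂ) w' := by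
  simp only [Complex.sq_norm, Complex.normSq_apply, Complex.sub_re, Complex.sub_im,
    Complex.mul_re, Complex.mul_im, Complex.I_re, Complex.I_im] at hz hw h₁ h₂
  apply Complex.ext
  · simp only [Complex.mul_re, Complex.conj_re, Complex.conj_im]
    linarith
  · simp only [Complex.mul_im, Complex.conj_re, Complex.conj_im]
    linarith

/-- Equality of `z * conj w` and of `|w|²` gives equality of the ratios `z / w`, stated without
division. -/
theorem mul_eq_mul_of_norm_sq_eq {z w z' w' : ℂ} (hw0 : w' ≠ 0) (hz : ‖z‖ ^ 2 = ‖z'‖ ^ 2)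
    (hw : ‖w‖ ^ 2 = ‖w'‖ ^ 2) (h₁ : ‖z - w‖ ^ 2 = ‖z' - w'‖ ^ 2)
    (h₂ : ‖z - Complex.I * w‖ ^ 2 = ‖z' - Complex.I * w'‖ ^ 2) : z * w' = z' * w := by
  have h := mul_conj_eq_of_norm_sq_eq hz hw h₁ h₂
  have hww : w * (starRingEnd ℂ) w = w' * (starRingEnd ℂ) w' := by
    rw [Complex.mul_conj, Complex.mul_conj, Complex.normSq_eq_norm_sq, Complex.normSq_eq_norm_sq,
      hw]
  refine mul_right_cancel₀ ((map_ne_zero (starRingEnd ℂ)).2 hw0) ?_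
  linear_combination w * h - z * hww

/-- On adjacent vertices the ratio of two signals with the same measurements agrees. -/
theorem div_eq_div_of_adj {n : ℕ} {v : Fin n → ℝ} {Γ : SimpleGraph (Fin n)} {f g : ℝ → ℂ}
    (h₀ : M₀ v g = M₀ v f) (h₁ : M₁ v Γ g = M₁ v Γ f) (h₂ : M₂ v Γ g = M₂ v Γ f) {j k : Fin n}
    (hjk : Γ.Adj j k) (hj : f (v j) ≠ 0) (hk : f (v k) ≠ 0) :
    g (v j) / f (v j) = g (v k) / f (v k) := by
  wlog hlt : j < k generalizing j k
  · exact (this hjk.symm hk hj (lt_of_le_of_ne (not_lt.1 hlt) hjk.ne.symm)).symm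
  have h := mul_eq_mul_of_norm_sq_eq hk (congrFun h₀ j) (congrFun h₀ k)
    (congrFun h₁ ⟨(j, k), hjk, hlt⟩) (congrFun h₂ ⟨(j, k), hjk, hlt⟩)
  rw [div_eq_div_iff hj hk, h, mul_comm]

theorem div_eq_div_of_reachable {n : ℕ} {v : Fin n → ℝ} {Γ : SimpleGraph (Fin n)} {f g : ℝ → ℂ}
    (h₀ : M₀ v g = M₀ v f) (h₁ : M₁ v Γ g = M₁ v Γ f) (h₂ : M₂ v Γ g = M₂ v Γ f)
    {j k : {j : Fin n | f (v j) ≠ 0}} (hjk : (nonvanishingSubgraph v Γ f).Reachable j k) :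
    g (v j) / f (v j) = g (v k) / f (v k) := by
  obtain ⟨p⟩ := hjk
  induction p with
  | nil => rfl
  | @cons a b _ hab _ ih => exact (div_eq_div_of_adj h₀ h₁ h₂ hab a.2 b.2).trans ih

end PhaseRetrieval

end SpikePhase

theorem mainTheorem3 (s : ℕ) (hs : 1 ≤ s) (Ω Λ : ℝ) (hΩ : 0 < Ω) (hΛ : 0 < Λ)
    (hΩΛ : Ω * Λ < 1 / 2)
    (n : ℕ) (v : Fin n → ℝ) (hv : Function.Injective v)
    (hvΩ : ∀ j, v j ∈ Set.Icc (-Ω) Ω) (Γ : SimpleGraph (Fin n))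
    (μ : ComplexMeasure ℝ) (hμ : μ ∈ sparseMeasures Λ s)
    (hK : ∃ K : (nonvanishingSubgraph v Γ (fourierC μ)).ConnectedComponent,
      (2 + 12 / Real.log (2 * (s : ℝ) / (Λ * Ω))) * (s : ℝ) ≤ (K.supp.ncard : ℝ)) :
    ∀ ν ∈ sparseMeasures Λ s,
      M₀ v (fourierC ν) = M₀ v (fourierC μ) →
      M₁ v Γ (fourierC ν) = M₁ v Γ (fourierC μ) →
      M₂ v Γ (fourierC ν) = M₂ v Γ (fourierC μ) →
      PhaseEquiv ν μ := by
  classical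
  intro ν hν h₀ h₁ h₂
  obtain ⟨K, hK⟩ := hK
  have hs' : (1 : ℝ) ≤ s := by exact_mod_cast hs
  -- The argument of the logarithm exceeds `1`, so the component has strictly more than `2 * s`
  -- vertices.
  have hlog : 0 < Real.log (2 * (s : ℝ) / (Λ * Ω)) := by
    refine Real.log_pos ?_
    rw [lt_div_iff₀ (mul_pos hΛ hΩ)]
    nlinarith
  have hcard : 2 * s < K.supp.ncard := by
    have : (2 * s : ℝ) < K.supp.ncard := by
      refine lt_of_lt_of_le ?_ hK
      have : 0 < 12 / Real.log (2 * (s : ℝ) / (Λ * Ω)) := by positivity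
      nlinarith
    exact_mod_cast this
  obtain ⟨j₀, rfl⟩ := K.exists_rep
  have hj₀ : fourierC μ (v j₀) ≠ 0 := j₀.2
  -- The phase is read off at one vertex of the component; `M₀` makes it unimodular.
  refine ⟨fourierC ν (v j₀) / fourierC μ (v j₀), ?_, ?_⟩
  · have h : ‖fourierC ν (v j₀)‖ ^ 2 = ‖fourierC μ (v j₀)‖ ^ 2 := congrFun h₀ j₀
    rw [norm_div, (sq_eq_sq₀ (norm_nonneg _) (norm_nonneg _)).1 h, div_self (norm_ne_zero_iff.2 hj₀)]
  · set K := (nonvanishingSubgraph v Γ (fourierC μ)).connectedComponentMk j₀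
    have hKfin : K.supp.Finite := Set.toFinite _
    refine eq_smul_of_fourierC_eq hΩ hΛ hΩΛ hμ hν _ (hKfin.toFinset.image (v ∘ Subtype.val)) ?_ ?_ ?_
    · intro w hw
      obtain ⟨j, _, rfl⟩ := Finset.mem_image.1 hw
      exact hvΩ j
    · rw [Finset.card_image_of_injective _ (hv.comp Subtype.val_injective),
        ← Set.ncard_eq_toFinset_card _ hKfin]
      exact hcard
    · intro w hw
      obtain ⟨j, hj, rfl⟩ := Finset.mem_image.1 hw
      have hj : j ∈ K.supp := hKfin.mem_toFinset.1 hj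
      have hr : (nonvanishingSubgraph v Γ (fourierC μ)).Reachable j₀ j :=
        (SimpleGraph.ConnectedComponent.exact hj).symm
      rw [div_eq_div_of_reachable h₀ h₁ h₂ hr]
      exact (div_mul_cancel₀ _ j.2).symm
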